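/- **Probabilistic completeness of the bundle planners QRRT, QRRT\*, QMP and QMP\*.** *Setting.* Let $X_K\xrightarrow{\pi_{K-1}}\cdots\xrightarrow{\pi_1}X_1$ ($K\ge 1$) be a sequence of fiber bundles of metric spaces: each $\pi_{k-1}:X_k\to X_{k-1}$ is locally trivial with fiber $F_k$. Each $X_k$ is a planning space: it has a constraint function $\phi_k:X_k\to\{0,1\}$, with free space $X_k^{\mathrm{free}}=\phi_k^{-1}(0)$, and a steering function, which assigns to every pair $(x,y)$ a continuous path from $x$ to $y$. The projections are admissible, $\phi_{k-1}(\pi_{k-1}(x))\le\phi_k(x)$. Let $x_I\in X_K^{\mathrm{free}}$ be an initial state and $X_G\subseteq X_K^{\mathrm{free}}$ a goal region, with projections $x_I^k\in X_k$ and $X_G^k\subseteq X_k$. The connected initial component $I_k$ is the set of points of $X_k^{\mathrm{free}}$ that are joined to $x_I^k$ by a path in $X_k^{\mathrm{free}}$. *Planners.* A bundle planner keeps on each level $k$ a finite graph $G_k$ in $X_k$, initially $\{x_I^k\}$, whose edges are motions, and a queue of levels, initially level $1$ alone. In every iteration, if the highest level $k<K$ in the queue is solved ($G_k$ contains a collision-free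 path from $x_I^k$ to $X_G^k$), then level $k+1$ is put into the queue, after a section search (any heuristic) has inserted finitely many collision-free motions, possibly none, into $G_{k+1}$. Otherwise the level in the queue of highest importance (a function of the level and of the number of its vertices) is selected and its graph is grown by one iteration of RRT (for QRRT), RRT\* (QRRT\*), PRM (QMP) or PRM\* (QMP\*), where the sample is a restriction sample. Growth continues after level $K$ has been solved. *Restriction sampling.* On level $1$ the samples $A_1$ are drawn in $X_1$. On a level $k\ge2$ a base element on the current graph $G_{k-1}$ (or in a prescribed neighborhood of it, for neighborhood sampling) and a fiber element in $F_k$ are drawn, and the sample is the lift of the pair to $X_k$. It is part of the definition of restriction sampling that almost surely, if level $k$ is selected infinitely often, the set $A_k$ of its samples is dense in the restriction $\pi_{k-1}^{-1}(V)$, where $V\subseteq X_{k-1}$ is the set of all vertices to which, at some iteration, the graph $G_{k-1}$ contains a path from $x_I^{k-1}$. The sampling need be neither independent nor uniform. *Assumptions.* Almost surely: 1. every level is selected infinitely often, once it is in the queue; 2. restriction sampling on level $1$ is dense in $X_1$; 3. for every level $k$ that is selected infinitely often, if $A_k$ is dense in $I_k$ (that is, $I_k\subseteq\overline{A_k}$),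 then $G_k$ is space-filling in $I_k$: for all $x\in I_k$ and $\varepsilon>0$, at all sufficiently late iterations $G_k$ contains a path from $x_I^k$ to a vertex at distance less than $\varepsilon$ from $x$. *Claim.* Under these assumptions each of the planners QRRT, QRRT\*, QMP and QMP\* is probabilistically complete: if there is a continuous path in the interior of $X_K^{\mathrm{free}}$ from $x_I$ to an interior point of $X_G$, then the probability that within the first $n$ iterations the graph $G_K$ contains a collision-free path from $x_I$ to $X_G$ tends to $1$ as $n\to\infty$. -/

import Mathlib

open Set Filter Topology MeasureTheory
open scoped ENNReal NNReal unitInterval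

namespace BundlePlanning

universe u v w

/-! ### Planning spaces, motions and graphs -/

/-- A planning space `(X, φ, ψ)`: a constraint function (`0` means feasible) and a steering function,
which joins any two states by a path and may ignore the constraint. -/
structure PlanningSpace (X : Type u) [TopologicalSpace X] where
  phi : X → Fin 2
  psi : ∀ x y : X, Path x y

/-- The free state space. -/
def PlanningSpace.free {X : Type u} [TopologicalSpace X] (S : PlanningSpace X) : Set X :=
  {x | S.phi x = 0}

/-- A motion: a continuous path with its two end points. -/
structure Motion (X : Type u) [TopologicalSpace X] where
  src : X
  tgt : X
  path : Path src tgt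

/-- The motion run backwards. -/
def Motion.reverse {X : Type u} [TopologicalSpace X] (m : Motion X) : Motion X :=
  ⟨m.tgt, m.src, m.path.symm⟩

/-- A collision check of a motion: all of its states are free. -/
def Motion.IsFree {X : Type u} [TopologicalSpace X] (S : PlanningSpace X) (m : Motion X) : Prop :=
  ∀ t, m.path t ∈ S.free

/-- A graph in `X`: finitely many vertices and finitely many (directed) edges, which are motions. -/
structure PGraph (X : Type u) [TopologicalSpace X] where
  V : Finset X
  E : Finset (Motion X)

namespace PGraph

variable {X : Type u} [TopologicalSpace X]

/-- The union of all vertices and all edges of a graph. -/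
def carrier (G : PGraph X) : Set X :=
  (G.V : Set X) ∪ ⋃ m ∈ G.E, range m.path

/-- The graph with the single vertex `x`. -/
def single (x : X) : PGraph X := ⟨{x}, ∅⟩

open Classical in
/-- `G ∪ {x}` -/
noncomputable def addVertex (G : PGraph X) (x : X) : PGraph X :=
  ⟨insert x G.V, G.E⟩

open Classical in
/-- `G` together with an edge and its two end points. -/
noncomputable def addMotion (G : PGraph X) (m : Motion X) : PGraph X :=
  ⟨insert m.src (insert m.tgt G.V), insert m G.E⟩

/-- `G` together with an edge that can be traversed in both directions. -/
noncomputable def addUndirected (G : PGraph X) (m : Motion X) : PGraph X :=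
  (G.addMotion m).addMotion m.reverse

open Classical in
/-- `G` without the edges into `y`. -/
noncomputable def removeIncoming (G : PGraph X) (y : X) : PGraph X :=
  ⟨G.V, G.E.filter fun m => m.tgt ≠ y⟩

/-- The continuous paths that one obtains by starting at a vertex and following edges. -/
inductive IsGraphPath (G : PGraph X) : ∀ {x y : X}, Path x y → Prop
  | refl (x : X) (hx : x ∈ G.V) : IsGraphPath G (Path.refl x)
  | trans {x y z : X} (p : Path x y) (e : Path y z) (hp : IsGraphPath G p)
      (he : (⟨y, z, e⟩ : Motion X) ∈ G.E) : IsGraphPath G (p.trans e)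

/-- There is a path in the graph from `r` to `x`. -/
def Reaches (G : PGraph X) (r x : X) : Prop :=
  ∃ p : Path r x, G.IsGraphPath p

/-- The graph contains a solution: a collision-free path in the graph from the initial state to a
state of the goal region. -/
def HasSolution (G : PGraph X) (S : PlanningSpace X) (xI : X) (XG : Set X) : Prop :=
  ∃ g ∈ XG, ∃ p : Path xI g, G.IsGraphPath p ∧ ∀ t, p t ∈ S.free

/-- The cost to come: the least cost of a path in the graph from `r` to `x` (`⊤` if there is none). -/
noncomputable def costToCome (G : PGraph X) (cost : Motion X → ℝ≥0) (r x : X) : ℝ≥0∞ :=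
  ⨅ p : {p : Path r x // G.IsGraphPath p}, (cost ⟨r, x, p.1⟩ : ℝ≥0∞)

end PGraph

/-- A time-indexed family of graphs is space-filling in `U`: in the limit, every point of `U` is
approached by end points of paths in the graph that start at `r`. -/
def SpaceFilling {X : Type u} [PseudoMetricSpace X] (G : ℕ → PGraph X) (r : X) (U : Set X) : Prop :=
  ∀ x ∈ U, ∀ ε > 0, ∀ᶠ n in atTop, ∃ v, dist v x < ε ∧ (G n).Reaches r v

/-! ### The grow functions -/

/-- The grow functions are those of RRT, RRT*, PRM and PRM*, respectively, fed with restriction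
samples. -/
inductive Planner
  | QRRT
  | QRRTstar
  | QMP
  | QMPstar

/-- What a planner needs to know about one bundle space in order to grow its graph. -/
structure GrowParams (X : Type u) [TopologicalSpace X] where
  /-- the cost functional -/
  cost : Motion X → ℝ≥0
  /-- steering stops when the distance exceeds this threshold (`⊤`: no threshold) -/
  range : ℝ≥0∞
  /-- number of neighbors in QMP -/
  kQMP : ℕ
  /-- QRRT* uses `kRRT * log N` neighbors -/
  kRRT : ℝ
  /-- QMP* uses `kPRM * log N` neighbors -/
  kPRM : ℝ

section Grow

variable {X : Type u} [PseudoMetricSpace X]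

open Classical in
/-- The `n` elements of `V` that are nearest to `x`, in the order of their distance. -/
noncomputable def kNearest (n : ℕ) (x : X) (V : Finset X) : List X :=
  (V.toList.insertionSort fun a b => dist x a ≤ dist x b).take n

/-- The largest `t` such that `γ` stays within distance `δ` of its initial point up to time `t`. -/
noncomputable def stopTime (δ : ℝ≥0∞) {x y : X} (γ : Path x y) : I :=
  projIcc 0 1 zero_le_one
    (sSup {t : ℝ | t ∈ Icc (0 : ℝ) 1 ∧ ∀ s ∈ Icc (0 : ℝ) t, edist x (γ.extend s) ≤ δ})

/-- Steer from `x` towards `y` up to the distance threshold `δ`. -/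
noncomputable def steer (S : PlanningSpace X) (δ : ℝ≥0∞) (x y : X) : Motion X :=
  ⟨x, S.psi x y (stopTime δ (S.psi x y)),
    ((S.psi x y).subpath 0 (stopTime δ (S.psi x y))).cast (by simp) rfl⟩

/-- The steering motion from `x` to `y` is collision-free. -/
def CheckMotion (S : PlanningSpace X) (x y : X) : Prop :=
  ∀ t, S.psi x y t ∈ S.free

open Classical in
/-- One iteration of RRT with the sample `xrand`; also returns the new vertex, if there is one. -/
noncomputable def growRRT (S : PlanningSpace X) (q : GrowParams X) (xrand : X) (G : PGraph X) :
    PGraph X × Option X :=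
  match (kNearest 1 xrand G.V).head? with
  | none => (G, none)
  | some xnear =>
    if CheckMotion S xnear xrand then
      (G.addMotion (steer S q.range xnear xrand), some (steer S q.range xnear xrand).tgt)
    else (G, none)

open Classical in
/-- Make `x` the predecessor of `y` if this lowers the cost to come of `y`. -/
noncomputable def rewire (S : PlanningSpace X) (q : GrowParams X) (xI : X) (G : PGraph X)
    (x y : X) : PGraph X :=
  if CheckMotion S x y ∧
      G.costToCome q.cost xI x + (q.cost ⟨x, y, S.psi x y⟩ : ℝ≥0∞) < G.costToCome q.cost xI y then
    (G.removeIncoming y).addMotion ⟨x, y, S.psi x y⟩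
  else G

open Classical in
/-- One iteration of RRT*: an iteration of RRT, and then the rewiring of the new vertex and its
nearest neighbors. -/
noncomputable def growRRTstar (S : PlanningSpace X) (q : GrowParams X) (xI : X) (xrand : X)
    (G : PGraph X) : PGraph X :=
  match growRRT S q xrand G with
  | (G₁, none) => G₁
  | (G₁, some xnew) =>
    let nbhs := kNearest ⌈q.kRRT * Real.log G₁.V.card⌉₊ xnew (G₁.V.erase xnew)
    let G₂ := nbhs.foldl (fun H xnbh => rewire S q xI H xnbh xnew) G₁
    nbhs.foldl (fun H xnbh => rewire S q xI H xnew xnbh) G₂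

open Classical in
/-- One iteration of PRM with `k N` neighbors, where `N` is the number of vertices. -/
noncomputable def growPRM (S : PlanningSpace X) (q : GrowParams X) (k : ℕ → ℕ) (xrand : X)
    (G : PGraph X) : PGraph X :=
  if xrand ∈ S.free then
    let G₁ := G.addVertex xrand
    (kNearest (k G₁.V.card) xrand (G₁.V.erase xrand)).foldl
      (fun H xnbh =>
        if CheckMotion S xnbh xrand then H.addUndirected (steer S q.range xnbh xrand) else H) G₁
  else G

/-- The grow function of the four planners. -/
noncomputable def Planner.grow (A : Planner) (S : PlanningSpace X) (q : GrowParams X) (xI : X)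
    (xrand : X) (G : PGraph X) : PGraph X :=
  match A with
  | .QRRT => (growRRT S q xrand G).1
  | .QRRTstar => growRRTstar S q xI xrand G
  | .QMP => growPRM S q (fun _ => q.kQMP) xrand G
  | .QMPstar => growPRM S q (fun N => ⌈q.kPRM * Real.log N⌉₊) xrand G

end Grow

/-! ### Fiber bundle sequences and multilevel problems -/

/-- A sequence of fiber bundles `X K → ⋯ → X 1 → X 0` with fibers `F`; `triv k b` is a local
trivialization over a neighborhood of `b`. -/
structure BundleSequence {K : ℕ} (X : Fin (K + 1) → Type u) [∀ k, MetricSpace (X k)]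
    (F : Fin K → Type v) [∀ k, TopologicalSpace (F k)] where
  proj : ∀ k : Fin K, X k.succ → X k.castSucc
  triv : ∀ (k : Fin K) (_ : X k.castSucc), Bundle.Trivialization (F k) (proj k)
  mem_triv : ∀ (k : Fin K) (b : X k.castSucc), b ∈ (triv k b).baseSet

section Problem

variable {K : ℕ} {X : Fin (K + 1) → Type u} [∀ k, MetricSpace (X k)]
  {F : Fin K → Type v} [∀ k, TopologicalSpace (F k)]

/-- The lift: the element of the fiber over `b` with fiber coordinate `f`. -/
def BundleSequence.lift (B : BundleSequence X F) (k : Fin K) (b : X k.castSucc) (f : F k) :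
    X k.succ :=
  (B.triv k b).toOpenPartialHomeomorph.symm (b, f)

/-- A multilevel motion planning problem: every bundle space is a planning space, and on the total
space there are an initial state and a goal region in the free space. -/
structure MultilevelProblem (X : Fin (K + 1) → Type u) [∀ k, MetricSpace (X k)]
    (F : Fin K → Type v) [∀ k, TopologicalSpace (F k)] extends BundleSequence X F where
  space : ∀ k, PlanningSpace (X k)
  xI : X (Fin.last K)
  XG : Set (X (Fin.last K))
  xI_free : xI ∈ (space (Fin.last K)).free
  XG_free : XG ⊆ (space (Fin.last K)).free

namespace MultilevelProblem

/-- All projections are admissible. -/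
def Admissible (M : MultilevelProblem X F) : Prop :=
  ∀ (k : Fin K) (x : X k.succ), (M.space k.castSucc).phi (M.proj k x) ≤ (M.space k.succ).phi x

/-- The initial state projected onto the `k`-th bundle space. -/
def start (M : MultilevelProblem X F) (k : Fin (K + 1)) : X k :=
  Fin.reverseInduction (motive := fun k => X k) M.xI (fun k x => M.proj k x) k

/-- The goal region projected onto the `k`-th bundle space. -/
def goal (M : MultilevelProblem X F) (k : Fin (K + 1)) : Set (X k) :=
  Fin.reverseInduction (motive := fun k => Set (X k)) M.XG (fun k U => M.proj k '' U) k

/-- The connected initial component: the states of the `k`-th bundle space that a feasible path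
joins to the projected initial state. -/
def initialComponent (M : MultilevelProblem X F) (k : Fin (K + 1)) : Set (X k) :=
  pathComponentIn (M.space k).free (M.start k)

/-- There is a solution in the interior of the free space, which ends in the interior of the goal
region. -/
def HasInteriorSolution (M : MultilevelProblem X F) : Prop :=
  ∃ g ∈ interior M.XG, JoinedIn (interior (M.space (Fin.last K)).free) M.xI g

end MultilevelProblem

/-! ### The bundle planner -/

/-- The primitive methods of a bundle planner, with their random draws on `Ω`. The draws are
numbered by the calls of the grow function on the respective level; they may depend on each other
and on everything that happened before. -/
structure Primitives {K : ℕ} (X : Fin (K + 1) → Type u) [∀ k, MetricSpace (X k)]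
    (F : Fin K → Type v) (Ω : Type w) where
  growParams : ∀ k, GrowParams (X k)
  /-- the importance of a level as a function of its number of vertices -/
  importance : Fin (K + 1) → ℕ → ℝ
  /-- the samples of the lowest bundle space -/
  drawBottom : ℕ → Ω → X 0
  /-- the samples of the graphs on the base spaces -/
  drawBase : ∀ k : Fin K, ℕ → Ω → X k.castSucc
  /-- the samples of the fibers -/
  drawFiber : ∀ k : Fin K, ℕ → Ω → F k
  /-- size of the neighborhood of the base graph in which `drawBase` samples; it is `0` unless
  neighborhood sampling is used -/
  nbhd : Fin K → ℕ → ℝ≥0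
  /-- the search for a path section when level `k + 1` is started, given the graph on level `k`:
  an arbitrary heuristic that proposes finitely many motions, and perhaps none -/
  findSection : ∀ k : Fin K, Ω → PGraph (X k.castSucc) → Finset (Motion (X k.succ))

/-- The `j`-th restriction sample on level `k`: the lift of a base sample and a fiber sample, or a
sample of the whole space if there is no base space. -/
def restrictionSample (M : MultilevelProblem X F) {Ω : Type w} (P : Primitives X F Ω)
    (k : Fin (K + 1)) (j : ℕ) (ω : Ω) : X k :=
  Fin.cases (motive := fun k => X k) (P.drawBottom j ω)
    (fun k => M.lift k (P.drawBase k j ω) (P.drawFiber k j ω)) k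

/-- The state of a bundle planner: the highest level that has been pushed into the queue, the graphs
on all levels, and the number of calls of the grow function on each level. -/
structure State {K : ℕ} (X : Fin (K + 1) → Type u) [∀ k, MetricSpace (X k)] where
  top : Fin (K + 1)
  graph : ∀ k, PGraph (X k)
  calls : Fin (K + 1) → ℕ

section Run

variable (M : MultilevelProblem X F) {Ω : Type w} (P : Primitives X F Ω) (A : Planner) (ω : Ω)

/-- The planner has only the lowest level, and each graph consists of the initial state. -/
def initState : State X :=
  ⟨0, fun k => PGraph.single (M.start k), fun _ => 0⟩

/-- The graph on the `k`-th bundle space contains a solution of the problem projected there. -/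
def SolvedAt (s : State X) (k : Fin (K + 1)) : Prop :=
  (s.graph k).HasSolution (M.space k) (M.start k) (M.goal k)

/-- Level `k` terminates and level `k + 1` is to be started. -/
def Advances (s : State X) (k : Fin K) : Prop :=
  s.top = k.castSucc ∧ SolvedAt M s k.castSucc

open Classical in
/-- Start level `k + 1`: insert the collision-free ones among the motions that the section search
proposes, and push the level into the queue. -/
noncomputable def push (s : State X) (k : Fin K) : State X where
  top := k.succ
  graph := Function.update s.graph k.succ
    (((P.findSection k ω (s.graph k.castSucc)).filter
      (fun m => m.IsFree (M.space k.succ))).toList.foldl PGraph.addMotion (s.graph k.succ))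
  calls := s.calls

/-- The level in the queue that has the highest importance. -/
noncomputable def select (s : State X) : Fin (K + 1) :=
  (Finset.exists_max_image (Finset.Iic s.top) (fun k => P.importance k (s.graph k).V.card)
    ⟨s.top, by simp⟩).choose

/-- Grow the graph on level `k` with the next restriction sample of this level. -/
noncomputable def growLevel (s : State X) (k : Fin (K + 1)) : State X where
  top := s.top
  graph := Function.update s.graph k
    (A.grow (M.space k) (P.growParams k) (M.start k) (restrictionSample M P k (s.calls k) ω)
      (s.graph k))
  calls := Function.update s.calls k (s.calls k + 1)

open Classical in
/-- One iteration: when the highest level in the queue is solved and is not the last one, the next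
level is started; otherwise the most important level is grown. -/
noncomputable def step (s : State X) : State X :=
  if h : ∃ k, Advances M s k then push M P ω s h.choose
  else growLevel M P A ω s (select P s)

/-- The state after `n` iterations. (Growth goes on after a solution has been found on the last
level, so that one can speak of the limit of infinite running time.) -/
noncomputable def run (n : ℕ) : State X :=
  (step M P A ω)^[n] (initState M)

/-- Iteration `n` grows the graph on level `k`. -/
def Grows (k : Fin (K + 1)) (n : ℕ) : Prop :=
  (¬ ∃ j, Advances M (run M P A ω n) j) ∧ select P (run M P A ω n) = k

/-- The graph on level `k` is grown infinitely often. -/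
def GrowsInfinitelyOften (k : Fin (K + 1)) : Prop :=
  ∃ᶠ n in atTop, Grows M P A ω k n

end Run

section Assumptions

variable (M : MultilevelProblem X F) {Ω : Type w} [MeasurableSpace Ω] (μ : Measure Ω)
  (P : Primitives X F Ω) (A : Planner)

/-- The planner uses restriction sampling. First, on a level with a base space it samples
exclusively over the current graph on the base space (or over a neighborhood of this graph, in the
case of neighborhood sampling). Second, almost surely, if it samples the level infinitely often, the
samples are dense in the restriction to the vertices of the base graphs that are connected to the
initial state. -/
structure IsRestrictionSampling : Prop where
  over_graph : ∀ᵐ ω ∂μ, ∀ (k : Fin K) (n : ℕ), Grows M P A ω k.succ n →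
    ∃ b ∈ ((run M P A ω n).graph k.castSucc).carrier,
      dist (P.drawBase k ((run M P A ω n).calls k.succ) ω) b
        ≤ P.nbhd k ((run M P A ω n).calls k.succ)
  dense_restriction : ∀ᵐ ω ∂μ, ∀ k : Fin K, GrowsInfinitelyOften M P A ω k.succ →
    M.proj k ⁻¹' {b | ∃ n, ((run M P A ω n).graph k.castSucc).Reaches (M.start k.castSucc) b} ⊆
      closure (range fun j => restrictionSample M P k.succ j ω)

/-- The importance is such that every level, once it is in the queue, is selected infinitely
often. -/
def SelectsInfinitelyOften : Prop :=
  ∀ᵐ ω ∂μ, ∀ k, (∃ n, k ≤ (run M P A ω n).top) → GrowsInfinitelyOften M P A ω k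

/-- Restriction sampling is dense in the lowest bundle space. -/
def BottomSamplingDense : Prop :=
  ∀ᵐ ω ∂μ, Dense (range fun j => restrictionSample M P 0 j ω)

/-- On a level that is selected infinitely often: if restriction sampling is dense in the connected
initial component, then the graph is space-filling there. -/
def GraphsSpaceFilling : Prop :=
  ∀ᵐ ω ∂μ, ∀ k, GrowsInfinitelyOften M P A ω k →
    M.initialComponent k ⊆ closure (range fun j => restrictionSample M P k j ω) →
    SpaceFilling (fun n => (run M P A ω n).graph k) (M.start k) (M.initialComponent k)

/-- Probabilistic completeness: if there is a solution in the interior of the free space, then the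
probability that the planner has found a solution on the total space within `n` iterations tends to
one. -/
def ProbabilisticallyComplete : Prop :=
  M.HasInteriorSolution →
    Tendsto (fun n => μ {ω | ∃ m ≤ n, SolvedAt M (run M P A ω m) (Fin.last K)}) atTop (𝓝 1)

end Assumptions

end Problem

end BundlePlanning

open BundlePlanning

/-!
Fix an outcome of the random draws that satisfies the assumptions, and suppose that there is an
interior solution. Two facts hold on every level `k`, whatever the planner does.

* All edges that the planner ever inserts are collision-free (`edgesFree_run`), because motions are
  checked before they are inserted and steering only shortens them. So a graph solves its level as
  soon as it connects the initial state to a single vertex in the goal region.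
* The projections are continuous and open, by local triviality, and they map free states to free
  states, by admissibility. So the interior solution projects to a path from the initial state to an
  interior point of the goal region on level `k` (`exists_interior_goal`), and a graph which is
  space-filling in the initial component has a connected vertex in the goal region at all late
  iterations (`eventually_solvedAt`).

By induction on `k`, every level gets into the queue and has a space-filling graph
(`mem_queue_and_spaceFilling`). When level `k` has a space-filling graph, it is solved from some iteration
on; hence level `k + 1` gets into the queue, and is selected infinitely often from then on. Its samples
are dense in the preimage of the set `V` of connected vertices of level `k`, and `V` is dense in the
initial component there. As the preimage of a dense set under an open map is dense, the samples are
dense in the initial component of level `k + 1`, whose graph is therefore space-filling.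

In particular the last level is almost surely solved after finitely many iterations, and the claim
follows by continuity of the measure from below.
-/

namespace BundlePlanning

universe u v w

/-! ### Collision-free edges -/

section Edges

variable {X : Type u}

/-- All edges of the graph are collision-free. -/
def PGraph.EdgesFree [TopologicalSpace X] (G : PGraph X) (S : PlanningSpace X) : Prop :=
  ∀ m ∈ G.E, m.IsFree S

namespace PGraph.EdgesFree

section Topological

variable [TopologicalSpace X] {S : PlanningSpace X} {G : PGraph X}

lemma single (x : X) : (PGraph.single x).EdgesFree S := by
  simp [PGraph.EdgesFree, PGraph.single]

lemma addVertex (hG : G.EdgesFree S) (x : X) : (G.addVertex x).EdgesFree S := hG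

lemma addMotion (hG : G.EdgesFree S) {m : Motion X} (hm : m.IsFree S) :
    (G.addMotion m).EdgesFree S := by
  classical
  intro e he
  rcases Finset.mem_insert.1 he with rfl | he
  · exact hm
  · exact hG e he

lemma addUndirected (hG : G.EdgesFree S) {m : Motion X} (hm : m.IsFree S) :
    (G.addUndirected m).EdgesFree S :=
  (hG.addMotion hm).addMotion fun t => hm (unitInterval.symm t)

lemma removeIncoming (hG : G.EdgesFree S) (y : X) : (G.removeIncoming y).EdgesFree S :=
  fun m hm => by
    classical
    exact hG m (Finset.mem_filter.1 hm).1

lemma foldl {α : Type v} {f : PGraph X → α → PGraph X} {l : List α}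
    (hf : ∀ H : PGraph X, H.EdgesFree S → ∀ a ∈ l, (f H a).EdgesFree S) (hG : G.EdgesFree S) :
    (l.foldl f G).EdgesFree S := by
  induction l generalizing G with
  | nil => exact hG
  | cons a l ih =>
    exact ih (fun H hH b hb => hf H hH b (List.mem_cons_of_mem a hb))
      (hf G hG a List.mem_cons_self)

lemma free_of_isGraphPath (hG : G.EdgesFree S) {x y : X} {p : Path x y} (hp : G.IsGraphPath p)
    (hx : x ∈ S.free) (t : I) : p t ∈ S.free := by
  suffices h : range p ⊆ S.free from h (mem_range_self t)
  clear t
  induction hp with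
  | refl _ => simpa using hx
  | trans p e _ he ih =>
    rw [Path.trans_range]
    exact union_subset ih (range_subset_iff.2 (hG _ he))

/-- If all edges are collision-free, a vertex in the goal region that is connected to the initial
state already gives a solution. -/
lemma hasSolution (hG : G.EdgesFree S) {x g : X} {U : Set X} (hx : x ∈ S.free) (hg : g ∈ U)
    (h : G.Reaches x g) : G.HasSolution S x U :=
  let ⟨p, hp⟩ := h
  ⟨g, hg, p, hp, hG.free_of_isGraphPath hp hx⟩

end Topological

variable [PseudoMetricSpace X] {S : PlanningSpace X} {G : PGraph X}

lemma isFree_steer {x y : X} (h : CheckMotion S x y) (δ : ℝ≥0∞) :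
    (steer S δ x y).IsFree S :=
  fun _ => h _

lemma growRRT (hG : G.EdgesFree S) (q : GrowParams X) (x : X) :
    (growRRT S q x G).1.EdgesFree S := by
  unfold BundlePlanning.growRRT
  split
  · exact hG
  · split_ifs with h
    · exact hG.addMotion (isFree_steer h _)
    · exact hG

lemma rewire (hG : G.EdgesFree S) (q : GrowParams X) (xI x y : X) :
    (rewire S q xI G x y).EdgesFree S := by
  unfold BundlePlanning.rewire
  split_ifs with h
  · exact (hG.removeIncoming y).addMotion h.1
  · exact hG

lemma growRRTstar (hG : G.EdgesFree S) (q : GrowParams X) (xI x : X) :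
    (growRRTstar S q xI x G).EdgesFree S := by
  have h := hG.growRRT q x
  unfold BundlePlanning.growRRTstar
  split
  · next heq => rwa [heq] at h
  · next heq =>
    rw [heq] at h
    exact foldl (fun H hH _ _ => hH.rewire _ _ _ _)
      (foldl (fun H hH _ _ => hH.rewire _ _ _ _) h)

lemma growPRM (hG : G.EdgesFree S) (q : GrowParams X) (k : ℕ → ℕ) (x : X) :
    (growPRM S q k x G).EdgesFree S := by
  unfold BundlePlanning.growPRM
  split_ifs
  · refine foldl (fun H hH y _ => ?_) (hG.addVertex x)
    split_ifs with h
    · exact hH.addUndirected (isFree_steer h _)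
    · exact hH
  · exact hG

lemma grow (hG : G.EdgesFree S) (A : Planner) (q : GrowParams X) (xI x : X) :
    (A.grow S q xI x G).EdgesFree S := by
  cases A
  · exact hG.growRRT q x
  · exact hG.growRRTstar q xI x
  · exact hG.growPRM q _ x
  · exact hG.growPRM q _ x

end PGraph.EdgesFree

end Edges

/-! ### Projections and projected solutions -/

section Bundle

variable {K : ℕ} {X : Fin (K + 1) → Type u} [∀ k, MetricSpace (X k)]
  {F : Fin K → Type v} [∀ k, TopologicalSpace (F k)]

namespace BundleSequence

variable (B : BundleSequence X F) (k : Fin K)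

lemma map_proj_nhds (x : X k.succ) : map (B.proj k) (𝓝 x) = 𝓝 (B.proj k x) :=
  (B.triv k (B.proj k x)).map_proj_nhds
    ((B.triv k (B.proj k x)).mem_source.2 (B.mem_triv k (B.proj k x)))

lemma continuous_proj : Continuous (B.proj k) :=
  continuous_iff_continuousAt.2 fun x => (B.map_proj_nhds k x).le

lemma isOpenMap_proj : IsOpenMap (B.proj k) :=
  isOpenMap_iff_nhds_le.2 fun x => (B.map_proj_nhds k x).ge

end BundleSequence

namespace MultilevelProblem

variable {M : MultilevelProblem X F}

lemma start_last : M.start (Fin.last K) = M.xI := by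
  simp [start]

lemma start_castSucc (k : Fin K) : M.start k.castSucc = M.proj k (M.start k.succ) := by
  simp [start]

lemma goal_last : M.goal (Fin.last K) = M.XG := by
  simp [goal]

lemma goal_castSucc (k : Fin K) : M.goal k.castSucc = M.proj k '' M.goal k.succ := by
  simp [goal]

lemma Admissible.mapsTo_free (hM : M.Admissible) (k : Fin K) :
    MapsTo (M.proj k) (M.space k.succ).free (M.space k.castSucc).free := fun x hx =>
  le_antisymm ((hM k x).trans (le_of_eq hx)) (Fin.zero_le _)

lemma Admissible.joinedIn_proj (hM : M.Admissible) (k : Fin K) {x y : X k.succ}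
    (h : JoinedIn (M.space k.succ).free x y) :
    JoinedIn (M.space k.castSucc).free (M.proj k x) (M.proj k y) :=
  let ⟨γ, hγ⟩ := h
  ⟨γ.map (M.continuous_proj k), fun t => hM.mapsTo_free k (hγ t)⟩

lemma Admissible.mapsTo_initialComponent (hM : M.Admissible) (k : Fin K) :
    MapsTo (M.proj k) (M.initialComponent k.succ) (M.initialComponent k.castSucc) := fun x hx => by
  have h := hM.joinedIn_proj k hx
  rwa [← start_castSucc] at h

/-- An interior solution on the total space projects to every level: the projected initial component
contains an interior point of the projected goal region. -/
lemma Admissible.exists_interior_goal (hM : M.Admissible) (h : M.HasInteriorSolution)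
    (k : Fin (K + 1)) : (interior (M.goal k) ∩ M.initialComponent k).Nonempty := by
  induction k using Fin.reverseInduction with
  | last =>
    obtain ⟨g, hg, hj⟩ := h
    refine ⟨g, by rwa [goal_last], ?_⟩
    have hj' := hj.mono interior_subset
    rwa [← start_last] at hj'
  | cast k ih =>
    obtain ⟨g, hg, hj⟩ := ih
    refine ⟨M.proj k g, ?_, hM.mapsTo_initialComponent k hj⟩
    rw [goal_castSucc]
    exact (M.isOpenMap_proj k).image_interior_subset _ (mem_image_of_mem _ hg)

end MultilevelProblem

end Bundle

/-! ### Runs of a bundle planner -/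

section Run

variable {K : ℕ} {X : Fin (K + 1) → Type u} [∀ k, MetricSpace (X k)]
  {F : Fin K → Type v} [∀ k, TopologicalSpace (F k)] {Ω : Type w}
  (M : MultilevelProblem X F) (P : Primitives X F Ω) (A : Planner) (ω : Ω)

lemma run_succ (n : ℕ) : run M P A ω (n + 1) = step M P A ω (run M P A ω n) :=
  Function.iterate_succ_apply' ..

lemma edgesFree_step {s : State X} (hs : ∀ k, (s.graph k).EdgesFree (M.space k))
    (k : Fin (K + 1)) : ((step M P A ω s).graph k).EdgesFree (M.space k) := by
  classical
  unfold step
  split_ifs with h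
  · generalize h.choose = j
    rcases eq_or_ne k j.succ with rfl | hk
    · simp only [push, Function.update_self]
      refine PGraph.EdgesFree.foldl (fun H hH m hm => hH.addMotion ?_) (hs _)
      exact (Finset.mem_filter.1 (Finset.mem_toList.1 hm)).2
    · simpa [push, Function.update_of_ne hk] using hs k
  · generalize select P s = j
    rcases eq_or_ne k j with rfl | hk
    · simpa [growLevel] using (hs k).grow A _ _ _
    · simpa [growLevel, Function.update_of_ne hk] using hs k

lemma edgesFree_run (n : ℕ) (k : Fin (K + 1)) :
    ((run M P A ω n).graph k).EdgesFree (M.space k) := by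
  induction n generalizing k with
  | zero => exact PGraph.EdgesFree.single _
  | succ n ih =>
    rw [run_succ]
    exact edgesFree_step M P A ω ih k

lemma top_step_of_advances {s : State X} {k : Fin K} (h : Advances M s k) :
    (step M P A ω s).top = k.succ := by
  have hex : ∃ j, Advances M s j := ⟨k, h⟩
  have hk : hex.choose = k := Fin.castSucc_injective K (hex.choose_spec.1.symm.trans h.1)
  simp [step, hex, push, hk]

lemma le_top_step (s : State X) : s.top ≤ (step M P A ω s).top := by
  by_cases h : ∃ k, Advances M s k
  · obtain ⟨k, hk⟩ := h
    rw [top_step_of_advances M P A ω hk, hk.1]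
    exact k.castSucc_lt_succ.le
  · simp [step, h, growLevel]

lemma monotone_top_run : Monotone fun n => (run M P A ω n).top :=
  monotone_nat_of_le_succ fun n => by
    rw [run_succ]
    exact le_top_step M P A ω _

variable {M P A ω}

/-- A level that is in the queue and solved from some iteration on is followed by the next one. -/
lemma exists_succ_le_top {k : Fin K} (hk : ∃ n, k.castSucc ≤ (run M P A ω n).top)
    (hs : ∀ᶠ n in atTop, SolvedAt M (run M P A ω n) k.castSucc) :
    ∃ n, k.succ ≤ (run M P A ω n).top := by
  obtain ⟨n₀, h₀⟩ := hk
  obtain ⟨n, hn, hsol⟩ := ((eventually_ge_atTop n₀).and hs).exists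
  rcases (h₀.trans (monotone_top_run M P A ω hn)).eq_or_lt with htop | htop
  · refine ⟨n + 1, ?_⟩
    rw [run_succ, top_step_of_advances M P A ω ⟨htop.symm, hsol⟩]
  · exact ⟨n, Fin.castSucc_lt_iff_succ_le.1 htop⟩

/-- A level whose graph fills the initial component is solved at all late iterations. -/
lemma eventually_solvedAt (hM : M.Admissible) (hI : M.HasInteriorSolution) {k : Fin (K + 1)}
    (hf : SpaceFilling (fun n => (run M P A ω n).graph k) (M.start k) (M.initialComponent k)) :
    ∀ᶠ n in atTop, SolvedAt M (run M P A ω n) k := by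
  obtain ⟨g, hg, hgI⟩ := hM.exists_interior_goal hI k
  obtain ⟨ε, hε, hball⟩ := Metric.mem_nhds_iff.1 (mem_interior_iff_mem_nhds.1 hg)
  filter_upwards [hf g hgI ε hε] with n ⟨v, hv, hr⟩
  exact (edgesFree_run M P A ω n k).hasSolution (JoinedIn.source_mem hgI) (hball hv) hr

/-- If the graph on level `k` fills the initial component, then restriction samples that are dense
over its connected vertices are dense in the initial component of level `k + 1`. -/
lemma initialComponent_succ_subset_closure (hM : M.Admissible) {k : Fin K} {T : Set (X k.succ)}
    (hf : SpaceFilling (fun n => (run M P A ω n).graph k.castSucc) (M.start k.castSucc)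
      (M.initialComponent k.castSucc))
    (hT : M.proj k ⁻¹' {b | ∃ n, ((run M P A ω n).graph k.castSucc).Reaches (M.start k.castSucc) b}
      ⊆ closure T) :
    M.initialComponent k.succ ⊆ closure T := by
  intro x hx
  refine closure_minimal hT isClosed_closure
    ((M.isOpenMap_proj k).preimage_closure_subset_closure_preimage ?_)
  refine Metric.mem_closure_iff.2 fun ε hε => ?_
  obtain ⟨n, v, hv, hr⟩ := (hf _ (hM.mapsTo_initialComponent k hx) ε hε).exists
  exact ⟨v, ⟨n, hr⟩, by rwa [dist_comm]⟩

/-- For an outcome of the draws that satisfies the assumptions, all levels get into the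
queue and all graphs fill the initial components. -/
lemma mem_queue_and_spaceFilling (hM : M.Admissible) (hI : M.HasInteriorSolution)
    (hS : ∀ k : Fin K, GrowsInfinitelyOften M P A ω k.succ →
      M.proj k ⁻¹' {b | ∃ n, ((run M P A ω n).graph k.castSucc).Reaches (M.start k.castSucc) b} ⊆
        closure (range fun j => restrictionSample M P k.succ j ω))
    (h1 : ∀ k, (∃ n, k ≤ (run M P A ω n).top) → GrowsInfinitelyOften M P A ω k)
    (h2 : Dense (range fun j => restrictionSample M P 0 j ω))
    (h3 : ∀ k, GrowsInfinitelyOften M P A ω k →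
      M.initialComponent k ⊆ closure (range fun j => restrictionSample M P k j ω) →
      SpaceFilling (fun n => (run M P A ω n).graph k) (M.start k) (M.initialComponent k))
    (k : Fin (K + 1)) :
    (∃ n, k ≤ (run M P A ω n).top) ∧
      SpaceFilling (fun n => (run M P A ω n).graph k) (M.start k) (M.initialComponent k) := by
  induction k using Fin.induction with
  | zero =>
    have htop : ∃ n, 0 ≤ (run M P A ω n).top := ⟨0, Fin.zero_le _⟩
    exact ⟨htop, h3 0 (h1 0 htop) fun x _ => h2 x⟩
  | succ k ih =>
    have htop := exists_succ_le_top ih.1 (eventually_solvedAt hM hI ih.2)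
    exact ⟨htop, h3 k.succ (h1 _ htop)
      (initialComponent_succ_subset_closure hM ih.2 (hS k (h1 _ htop)))⟩

end Run

end BundlePlanning

theorem mainTheorem2 {K : ℕ} {X : Fin (K + 1) → Type*} [∀ k, MetricSpace (X k)]
    {F : Fin K → Type*} [∀ k, TopologicalSpace (F k)]
    {Ω : Type*} [MeasurableSpace Ω] (μ : Measure Ω) [IsProbabilityMeasure μ]
    (M : MultilevelProblem X F) (hM : M.Admissible)
    (A : Planner) (P : Primitives X F Ω)
    (hS : IsRestrictionSampling M μ P A)
    (h1 : SelectsInfinitelyOften M μ P A)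
    (h2 : BottomSamplingDense M μ P)
    (h3 : GraphsSpaceFilling M μ P A) :
    ProbabilisticallyComplete M μ P A := by
  intro hI
  have hae : ∀ᵐ ω ∂μ, ω ∈ ⋃ n, {ω | ∃ m ≤ n, SolvedAt M (run M P A ω m) (Fin.last K)} := by
    filter_upwards [hS.dense_restriction, h1, h2, h3] with ω hS h1 h2 h3
    obtain ⟨n, hn⟩ := (eventually_solvedAt hM hI
      (mem_queue_and_spaceFilling hM hI hS h1 h2 h3 (Fin.last K)).2).exists
    exact mem_iUnion.2 ⟨n, n, le_rfl, hn⟩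
  have hmono : Monotone fun n => {ω | ∃ m ≤ n, SolvedAt M (run M P A ω m) (Fin.last K)} :=
    fun n n' hn ω ⟨m, hm, h⟩ => ⟨m, hm.trans hn, h⟩
  -- Continuity from below holds for outer measures, so the events need not be measurable.
  have hlim := tendsto_measure_iUnion_atTop (μ := μ) hmono
  rwa [show μ (⋃ n, {ω | ∃ m ≤ n, SolvedAt M (run M P A ω m) (Fin.last K)}) = 1 from
    (measure_congr (eventuallyEq_univ.2 hae)).trans measure_univ] at hlim
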